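/- A hypergraph is a pair $(V,E)$ where $V$ is a finite set of vertices and $E$ is a multiset of subsets of $V$, each containing at least two vertices. A walk is a sequence $v_0,e_1,v_1,\dots,e_m,v_m$ with $v_i\in V$, $e_i\in E$ and $\{v_{i-1},v_i\}\subseteq e_i$; it is a path if all $v_i$ are distinct and all $e_i$ are distinct, and a cycle if $m\ge 2$, all $e_i$ are distinct, and all $v_i$ are distinct except that $v_0=v_m$ (copies of a repeated edge count as different edges). A hypergraph is connected if any two vertices are joined by a path, and a hypertree is a connected hypergraph with no cycles. A labeled hypergraph on $[n]$ with $\lambda_i$ edges of size $i$ ($i\ge2$) has its vertices labeled by $[n]$ and, for each $i$, its edges of size $i$ labeled by $[\lambda_i]$. For $n\ge 1$ and a finitely supported sequence $\lambda=(\lambda_2,\lambda_3,\dots)$ of nonnegative integers, let $\tau_{n,\lambda}$ be the number of labeled hypertrees on $[n]$ with $\lambda_i$ edges of size $i$ for each $i$, and let $\rho_{n,\lambda}$ be the number of such labeled hypertrees together with a distinguished vertex (the root). Put $$T=\sum_{n\ge1}\sum_\lambda \tau_{n,\lambda}\,\frac{t^n}{n!}\prod_{i\ge2}\frac{u_i^{\lambda_i}}{\lambda_i!},\qquad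 R=\sum_{n\ge1}\sum_\lambda \rho_{n,\lambda}\,\frac{t^n}{n!}\prod_{i\ge2}\frac{u_i^{\lambda_i}}{\lambda_i!},$$ as formal power series in the indeterminates $t,u_2,u_3,\dots$ over $\mathbb{Q}$. Then $R=t\,\dfrac{\partial T}{\partial t}$, and, as an identity of formal power series (in which all compositions are well defined), $$R=t\exp\Bigl(\sum_{j=1}^{\infty}u_{j+1}\frac{R^j}{j!}\Bigr).$$ -/

import Mathlib

/-- A hypergraph with vertex set `V` whose edges form a multiset of subsets of `V`, each with at
least two vertices. The multiset is given as a family indexed by a type `E`, so that multiple edges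
are allowed and are told apart by their index. -/
@[ext]
structure MultiHypergraph (V E : Type*) where
  /-- the set of vertices of an edge -/
  verts : E → Finset V
  two_le_card : ∀ e, 2 ≤ (verts e).card

namespace MultiHypergraph

variable {V E : Type*} (H : MultiHypergraph V E) {m : ℕ}

/-- `v 0, e 0, v 1, e 1, …, e (m - 1), v m` is a walk: each edge contains the vertex before it and
the vertex after it. -/
def IsWalk (v : Fin (m + 1) → V) (e : Fin m → E) : Prop :=
  ∀ i : Fin m, v i.castSucc ∈ H.verts (e i) ∧ v i.succ ∈ H.verts (e i)

/-- A path is a walk in which all vertices are distinct and all edges are distinct. -/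
def IsPath (v : Fin (m + 1) → V) (e : Fin m → E) : Prop :=
  H.IsWalk v e ∧ Function.Injective v ∧ Function.Injective e

/-- A cycle is a walk with at least two edges in which all edges are distinct and all vertices are
distinct, except that the first vertex equals the last. -/
def IsCycle (v : Fin (m + 1) → V) (e : Fin m → E) : Prop :=
  H.IsWalk v e ∧ 2 ≤ m ∧ Function.Injective e ∧
    v 0 = v (Fin.last m) ∧ Function.Injective fun i : Fin m => v i.castSucc

/-- Any two vertices are joined by a path. -/
def IsConnected : Prop :=
  ∀ x y : V, ∃ (m : ℕ) (v : Fin (m + 1) → V) (e : Fin m → E),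
    H.IsPath v e ∧ v 0 = x ∧ v (Fin.last m) = y

/-- A hypertree is a connected hypergraph with no cycles. -/
def IsHypertree : Prop :=
  H.IsConnected ∧ ∀ (m : ℕ) (v : Fin (m + 1) → V) (e : Fin m → E), ¬ H.IsCycle v e

end MultiHypergraph

/-- A labeled hypergraph on `n` vertices with `lam i` edges of size `i` for each `i`: the vertices
are labeled by `Fin n`, and for each `i` the edges of size `i` are labeled by `Fin (lam i)`.
There is none if `lam 0 ≠ 0` or `lam 1 ≠ 0`, because edges have at least two vertices. -/
@[ext]
structure LabeledHypergraph (n : ℕ) (lam : ℕ →₀ ℕ) extends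
    MultiHypergraph (Fin n) (Σ i : ℕ, Fin (lam i)) where
  card_verts : ∀ x : (Σ i : ℕ, Fin (lam i)), (verts x).card = x.1

/-- There are finitely many edge labels. -/
instance finite_edgeLabels (lam : ℕ →₀ ℕ) : Finite (Σ i : ℕ, Fin (lam i)) := by
  refine Finite.of_injective
    (fun x : (Σ i : ℕ, Fin (lam i)) =>
      (⟨⟨x.1, Finsupp.mem_support_iff.2 (by have := x.2.isLt; omega)⟩, x.2⟩ :
        Σ i : lam.support, Fin (lam i))) ?_
  rintro ⟨i, a⟩ ⟨j, b⟩ h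
  simp only [Sigma.mk.injEq, Subtype.mk.injEq] at h
  obtain ⟨rfl, h⟩ := h
  simpa using h

/-- There are finitely many labeled hypergraphs of a given type. -/
instance finite_labeledHypergraph (n : ℕ) (lam : ℕ →₀ ℕ) : Finite (LabeledHypergraph n lam) :=
  Finite.of_injective (fun H : LabeledHypergraph n lam => H.verts)
    fun _ _ h => LabeledHypergraph.ext h

/-- The number of labeled hypertrees on `n` vertices with `lam i` edges of size `i`. -/
noncomputable def hypertreeCount (n : ℕ) (lam : ℕ →₀ ℕ) : ℕ :=
  Nat.card {H : LabeledHypergraph n lam // H.toMultiHypergraph.IsHypertree}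

/-- The number of labeled hypertrees on `n` vertices with `lam i` edges of size `i`, together with a
distinguished vertex, the root. -/
noncomputable def rootedHypertreeCount (n : ℕ) (lam : ℕ →₀ ℕ) : ℕ :=
  Nat.card {p : LabeledHypergraph n lam × Fin n // p.1.toMultiHypergraph.IsHypertree}

/-- The ring of formal power series over `ℚ` in the indeterminates `u i`. -/
abbrev EdgeRing : Type := MvPowerSeries ℕ ℚ

/-- The power series in the `u i` with coefficient `f lam` at `∏ i, (u i) ^ (lam i)`. -/
def EdgeRing.ofCoeff (f : (ℕ →₀ ℕ) → ℚ) : EdgeRing := f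

theorem EdgeRing.coeff_ofCoeff (f : (ℕ →₀ ℕ) → ℚ) (lam : ℕ →₀ ℕ) :
    MvPowerSeries.coeff lam (EdgeRing.ofCoeff f) = f lam := rfl

/-- The exponential generating function
`∑ n, ∑ lam, c n lam * (t ^ n / n!) * ∏ i, (u i) ^ (lam i) / (lam i)!`,
as a power series in `t` over the power series in the `u i`. -/
noncomputable def egf (c : ℕ → (ℕ →₀ ℕ) → ℕ) : PowerSeries EdgeRing :=
  PowerSeries.mk fun n => EdgeRing.ofCoeff fun lam =>
    (c n lam : ℚ) / ((n.factorial : ℚ) * lam.prod fun _ k => (k.factorial : ℚ))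

/-- The exponential generating function `T` of labeled hypertrees on at least one vertex. -/
noncomputable def hypertreeEGF : PowerSeries EdgeRing :=
  egf fun n lam => if n = 0 then 0 else hypertreeCount n lam

/-- The exponential generating function `R` of vertex-rooted labeled hypertrees. -/
noncomputable def rootedHypertreeEGF : PowerSeries EdgeRing :=
  egf rootedHypertreeCount

/-- The power series `∑_{j ≥ 1} u (j + 1) * x ^ j / j!` in `x`. -/
noncomputable def edgeSeries : PowerSeries EdgeRing :=
  PowerSeries.mk fun j =>
    if j = 0 then 0 else ((j.factorial : ℚ)⁻¹) • (MvPowerSeries.X (j + 1) : EdgeRing)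

/-!
A root orients a hypertree: each edge consists of a parent, its vertex nearest to the root, and
children, and each vertex other than the root is a child in exactly one edge. Conversely, build a
rooted forest on `n` vertices one edge at a time: the parent in a new edge is arbitrary, and its
children are roots of other components. When `S` vertices are children already, there are
`n * (n - 1 - S).choose s` ways to add an edge with `s` children, so there are
`n ^ k * (n - 1)! / ∏ s!` rooted hypertrees with `k` edges and prescribed numbers `s` of children.
Up to the normalization of the generating function, this is `1 / n` times a coefficient of
`exp (∑ u (j + 1) * x ^ j / j!) ^ n`, and Lagrange inversion turns that description of the
coefficients of `R` into the functional equation.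
-/

section LagrangeInversion

open PowerSeries

variable {A : Type*} [CommRing A]

theorem eq_zero_of_derivative_eq_mul [IsAddTorsionFree A] {c f : A⟦X⟧}
    (hf : derivative A f = c * f) (h0 : constantCoeff f = 0) : f = 0 := by
  ext n
  induction n using Nat.strong_induction_on with
  | _ n ih =>
    cases n with
    | zero => simpa using h0
    | succ n =>
      have h : (n + 1) • coeff (n + 1) f = coeff n (c * f) := by
        rw [← hf, coeff_derivative, nsmul_eq_mul, mul_comm, Nat.cast_add_one]
      rw [coeff_mul, Finset.sum_eq_zero] at h
      · exact nsmul_right_injective n.succ_ne_zero (h.trans (nsmul_zero _).symm)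
      · intro p hp
        rw [ih p.2 (Nat.lt_succ_of_le (Finset.HasAntidiagonal.antidiagonal.snd_le hp)), map_zero,
          mul_zero]

theorem eq_of_derivative_eq_mul [IsAddTorsionFree A] {c f g : A⟦X⟧}
    (hf : derivative A f = c * f) (hg : derivative A g = c * g)
    (h0 : constantCoeff f = constantCoeff g) : f = g := by
  rw [← sub_eq_zero]
  apply eq_zero_of_derivative_eq_mul (c := c)
  · rw [map_sub, hf, hg, mul_sub]
  · rw [map_sub, h0, sub_self]

theorem constantCoeff_mul_coeff_one_of_mul_eq_X {φ h : A⟦X⟧} (hφh : φ * h = X)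
    (h0 : constantCoeff h = 0) : constantCoeff φ * coeff 1 h = 1 := by
  simpa [coeff_one_mul, h0, mul_comm] using congrArg (coeff 1) hφh

-- Since `φ = X / h`, this says that `h' / h ^ (n + 2)`, which is a derivative, has no residue.
theorem coeff_pow_mul_derivative_of_mul_eq_X [IsAddTorsionFree A] {φ h : A⟦X⟧}
    (hφh : φ * h = X) (n : ℕ) : coeff (n + 1) (φ ^ (n + 2) * derivative A h) = 0 := by
  have hD : φ * derivative A h + h * derivative A φ = 1 := by
    simpa only [Derivation.leibniz, derivative_X, smul_eq_mul] using
      congrArg (derivative A) hφh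
  have key : (n + 1) • (φ ^ (n + 2) * derivative A h) =
      (n + 1) • φ ^ (n + 1) - X * derivative A (φ ^ (n + 1)) := by
    rw [derivative_pow, ← hφh, nsmul_eq_mul, nsmul_eq_mul, Nat.add_sub_cancel]
    linear_combination (φ ^ (n + 1) * ((n + 1 : ℕ) : A⟦X⟧)) * hD
  refine nsmul_right_injective n.succ_ne_zero (Eq.trans ?_ (nsmul_zero _).symm)
  change (n + 1) • _ = _
  rw [← map_nsmul, key, map_sub, map_nsmul, coeff_succ_X_mul, coeff_derivative, nsmul_eq_mul,
    Nat.cast_add_one, mul_comm, sub_self]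

theorem exists_subst_eq_C_add_mul_subst {h : A⟦X⟧} (hs : HasSubst h) (G : A⟦X⟧) :
    ∃ G' : A⟦X⟧, (∀ n, coeff n G' = coeff (n + 1) G) ∧
      G.subst h = C (constantCoeff G) + h * G'.subst h := by
  refine ⟨mk fun n => coeff (n + 1) G, fun n => coeff_mk _ _, ?_⟩
  conv_lhs => rw [eq_X_mul_shift_add_const G]
  rw [subst_add hs, subst_mul hs, subst_X hs, subst_C, add_comm]
  rfl

/- The left-hand side is the residue of `G(h) h' / h ^ (n + 1)`, which the change of variable
`x = h` turns into the residue of `G / x ^ (n + 1)`. -/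
theorem coeff_pow_mul_subst_mul_derivative_of_mul_eq_X [IsAddTorsionFree A] {φ h : A⟦X⟧}
    (hφh : φ * h = X) (h0 : constantCoeff h = 0) (n : ℕ) (G : A⟦X⟧) :
    coeff n (φ ^ (n + 1) * (G.subst h * derivative A h)) = coeff n G := by
  have hs : HasSubst h := .of_constantCoeff_zero' h0
  induction n generalizing G with
  | zero =>
    obtain ⟨G', -, hG⟩ := exists_subst_eq_C_add_mul_subst hs G
    have h1 : constantCoeff φ * constantCoeff (derivative A h) = 1 := by
      rw [← coeff_zero_eq_constantCoeff_apply (derivative A h), coeff_derivative, Nat.cast_zero,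
        zero_add, zero_add, mul_one, constantCoeff_mul_coeff_one_of_mul_eq_X hφh h0]
    rw [hG]
    simp only [coeff_zero_eq_constantCoeff, zero_add, pow_one, map_mul, map_add,
      constantCoeff_C, h0, zero_mul, add_zero]
    linear_combination constantCoeff G * h1
  | succ n ih =>
    obtain ⟨G', hG', hG⟩ := exists_subst_eq_C_add_mul_subst hs G
    have key : φ ^ (n + 2) * (G.subst h * derivative A h) =
        C (constantCoeff G) * (φ ^ (n + 2) * derivative A h) +
          X * (φ ^ (n + 1) * (G'.subst h * derivative A h)) := by
      rw [hG, ← hφh]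
      ring
    rw [key, map_add, coeff_C_mul, coeff_pow_mul_derivative_of_mul_eq_X hφh, coeff_succ_X_mul,
      ih, hG', mul_zero, zero_add]

theorem nsmul_coeff_succ_substInvOfIsUnit [IsAddTorsionFree A] {φ h : A⟦X⟧} (hφh : φ * h = X)
    (h0 : constantCoeff h = 0) (h1 : IsUnit (coeff 1 h)) (n : ℕ) :
    (n + 1) • coeff (n + 1) (h.substInvOfIsUnit h1) = coeff n (φ ^ (n + 1)) := by
  set S := h.substInvOfIsUnit h1
  have hs : HasSubst h := .of_constantCoeff_zero' h0
  have chain_rule : (derivative A S).subst h * derivative A h = 1 := by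
    rw [← derivative_subst hs, subst_substInvOfIsUnit_left h h0 h1, derivative_X]
  rw [← mul_one (φ ^ (n + 1)), ← chain_rule,
    coeff_pow_mul_subst_mul_derivative_of_mul_eq_X hφh h0, coeff_derivative, nsmul_eq_mul,
    mul_comm, Nat.cast_add_one]

theorem substInvOfIsUnit_eq_X_mul_subst {φ h : A⟦X⟧} (hφh : φ * h = X)
    (h0 : constantCoeff h = 0) (h1 : IsUnit (coeff 1 h)) :
    h.substInvOfIsUnit h1 = X * φ.subst (h.substInvOfIsUnit h1) := by
  set S := h.substInvOfIsUnit h1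
  have hS : HasSubst S := .of_constantCoeff_zero' (by simp [S])
  calc S = (φ * h).subst S := by rw [hφh, subst_X hS]
    _ = X * φ.subst S := by
      rw [subst_mul hS, subst_substInvOfIsUnit_right h h0 h1, mul_comm]

theorem lagrange_inversion [IsAddTorsionFree A] {φ R : A⟦X⟧} (hφ : IsUnit (constantCoeff φ))
    (hR0 : constantCoeff R = 0)
    (hR : ∀ n, (n + 1) • coeff (n + 1) R = coeff n (φ ^ (n + 1))) :
    R = X * φ.subst R := by
  obtain ⟨ψ, hφψ⟩ := (isUnit_iff_constantCoeff.2 hφ).exists_right_inv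
  have hφh : φ * (X * ψ) = X := by rw [mul_left_comm, hφψ, mul_one]
  have h0 : constantCoeff (X * ψ) = 0 := by simp
  have h1 : IsUnit (coeff 1 (X * ψ)) :=
    .of_mul_eq_one_right _ (constantCoeff_mul_coeff_one_of_mul_eq_X hφh h0)
  suffices R = (X * ψ).substInvOfIsUnit h1 by
    rw [this]
    exact substInvOfIsUnit_eq_X_mul_subst hφh h0 h1
  ext n
  cases n with
  | zero => simp [hR0]
  | succ n =>
    exact nsmul_right_injective n.succ_ne_zero
      ((hR n).trans (nsmul_coeff_succ_substInvOfIsUnit hφh h0 h1 n).symm)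

end LagrangeInversion

theorem exists_adj_dist_lt {V : Type*} {G : SimpleGraph V} (hG : G.Connected) {u a : V}
    (ha : u ≠ a) : ∃ b, G.Adj a b ∧ G.dist u b < G.dist u a := by
  obtain ⟨p, hp⟩ := hG.exists_walk_length_eq_dist u a
  have hnil : ¬ p.Nil := SimpleGraph.Walk.not_nil_of_ne ha
  refine ⟨p.penultimate, (p.adj_penultimate hnil).symm, ?_⟩
  have h1 := SimpleGraph.dist_le p.dropLast
  have h2 := p.length_dropLast_add_one hnil
  omega

theorem existsUnique_adj_dist_lt {V : Type*} {G : SimpleGraph V} (hG : G.IsTree) {u a : V}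
    (ha : u ≠ a) : ∃! b, G.Adj a b ∧ G.dist u b < G.dist u a := by
  obtain ⟨p, hp, -⟩ := hG.connected.exists_path_of_dist u a
  have eq_penultimate {b : V} (hb : G.Adj a b ∧ G.dist u b < G.dist u a) :
      b = p.penultimate := by
    obtain ⟨q, hq, hql⟩ := hG.connected.exists_path_of_dist u b
    refine hG.isAcyclic.eq_penultimate_of_adj_end hp hb.1
      (hG.isAcyclic.mem_support_of_ne_mem_support_of_adj_of_isPath hp hq hb.1 fun ha => ?_)
    have hlen := congrArg SimpleGraph.Walk.length (hG.isAcyclic.path_concat hp hq hb.1 ha)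
    rw [SimpleGraph.Walk.length_concat] at hlen
    have := SimpleGraph.dist_le p
    have := hb.2
    omega
  obtain ⟨b, hb⟩ := exists_adj_dist_lt hG.connected ha
  exact ⟨b, hb, fun c hc => (eq_penultimate hc).trans (eq_penultimate hb).symm⟩

section EdgeSeries

open PowerSeries

instance isAddTorsionFree_edgeRing : IsAddTorsionFree EdgeRing :=
  IsAddTorsionFree.of_module_rat _

/-- The number `∑ (i - 1) * lam i`, one less than the number of vertices of a hypertree with `lam i`
edges of size `i`. -/
def edgeWeight (lam : ℕ →₀ ℕ) : ℕ := lam.sum fun i k => k * (i - 1)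

/-- The denominator `∏ (lam i)! * (i - 1)! ^ (lam i)` of the coefficients of the powers of
`exp edgeSeries`. -/
def edgeDenom (lam : ℕ →₀ ℕ) : ℕ := lam.prod fun i k => k.factorial * (i - 1).factorial ^ k

/-- The types `lam` of hypertrees on `N + 1` vertices: all edges have at least two vertices, and the
edge weight is `N`. -/
def IsHypertreeType (lam : ℕ →₀ ℕ) (N : ℕ) : Prop :=
  (∀ i < 2, lam i = 0) ∧ edgeWeight lam = N

instance (lam : ℕ →₀ ℕ) (N : ℕ) : Decidable (IsHypertreeType lam N) :=
  inferInstanceAs (Decidable (_ ∧ _))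

theorem edgeWeight_add_single (lam : ℕ →₀ ℕ) (i : ℕ) :
    edgeWeight (lam + Finsupp.single i 1) = edgeWeight lam + (i - 1) := by
  unfold edgeWeight
  rw [Finsupp.sum_add_index' (by simp) (by intros; ring), Finsupp.sum_single_index (by simp),
    one_mul]

theorem edgeDenom_ne_zero (lam : ℕ →₀ ℕ) : edgeDenom lam ≠ 0 :=
  Finset.prod_ne_zero_iff.2 fun _ _ => by positivity

theorem edgeDenom_add_single (lam : ℕ →₀ ℕ) (i : ℕ) :
    edgeDenom (lam + Finsupp.single i 1) = edgeDenom lam * (lam i + 1) * (i - 1).factorial := by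
  have mul_erase (mu : ℕ →₀ ℕ) :
      ((mu i).factorial * (i - 1).factorial ^ mu i) * edgeDenom (mu.erase i) = edgeDenom mu :=
    Finsupp.mul_prod_erase' mu i (fun i k => k.factorial * (i - 1).factorial ^ k) fun _ => by simp
  have erase_add : (lam + Finsupp.single i 1).erase i = lam.erase i := by simp
  rw [← mul_erase (lam + _), ← mul_erase lam, erase_add, Finsupp.add_apply,
    Finsupp.single_eq_same, Nat.factorial_succ, pow_succ]
  ring

theorem isHypertreeType_add_single {lam : ℕ →₀ ℕ} {a b : ℕ} :
    IsHypertreeType (lam + Finsupp.single (a + 2) 1) (a + b + 1) ↔ IsHypertreeType lam b := by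
  refine and_congr (forall₂_congr fun i hi => ?_) ?_
  · rw [Finsupp.add_apply, Finsupp.single_eq_of_ne (by omega), add_zero]
  · rw [edgeWeight_add_single]
    omega

theorem IsHypertreeType.sum_range {lam : ℕ →₀ ℕ} {N : ℕ} (h : IsHypertreeType lam N) :
    ∑ a ∈ Finset.range N, lam (a + 2) * (a + 1) = N := by
  have support_lt {i : ℕ} (hi : i ∈ lam.support) : i < N + 2 := by
    have h1 : lam i * (i - 1) ≤ edgeWeight lam :=
      Finset.single_le_sum (f := fun i => lam i * (i - 1)) (fun _ _ => Nat.zero_le _) hi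
    have h2 : i - 1 ≤ lam i * (i - 1) :=
      Nat.le_mul_of_pos_left _ (Nat.pos_of_ne_zero (Finsupp.mem_support_iff.1 hi))
    have := h.2
    omega
  calc ∑ a ∈ Finset.range N, lam (a + 2) * (a + 1)
      = ∑ i ∈ Finset.range (N + 2), lam i * (i - 1) := by
        simp [Finset.sum_range_succ' _ (N + 1), Finset.sum_range_succ' _ N, h.1 0 two_pos]
    _ = edgeWeight lam :=
        (Finsupp.sum_of_support_subset lam (fun i hi => Finset.mem_range.2 (support_lt hi))
          (fun i k => k * (i - 1)) fun _ _ => zero_mul _).symm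
    _ = N := h.2

theorem isHypertreeType_zero_iff {lam : ℕ →₀ ℕ} : IsHypertreeType lam 0 ↔ lam = 0 := by
  refine ⟨fun h => ?_, by rintro rfl; exact ⟨fun _ _ => rfl, rfl⟩⟩
  ext i
  by_contra hi
  have h2 : 2 ≤ i := not_lt.1 fun h2 => hi (h.1 i h2)
  have := Finset.sum_eq_zero_iff.1 h.2 i (Finsupp.mem_support_iff.2 hi)
  rcases Nat.mul_eq_zero.1 this with h' | h'
  · exact hi h'
  · omega

/-- The series `exp (c * edgeSeries)`, given by its coefficients. -/
noncomputable def expSMulEdgeSeries (c : ℚ) : PowerSeries EdgeRing :=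
  PowerSeries.mk fun N => EdgeRing.ofCoeff fun lam =>
    if IsHypertreeType lam N then c ^ lam.degree / edgeDenom lam else 0

theorem coeff_expSMulEdgeSeries (c : ℚ) (N : ℕ) (lam : ℕ →₀ ℕ) :
    MvPowerSeries.coeff lam (coeff N (expSMulEdgeSeries c)) =
      if IsHypertreeType lam N then c ^ lam.degree / edgeDenom lam else 0 := by
  rw [expSMulEdgeSeries, coeff_mk, EdgeRing.coeff_ofCoeff]

theorem constantCoeff_expSMulEdgeSeries (c : ℚ) :
    constantCoeff (expSMulEdgeSeries c) = 1 := by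
  rw [← coeff_zero_eq_constantCoeff_apply]
  ext lam
  simp only [coeff_expSMulEdgeSeries, isHypertreeType_zero_iff, MvPowerSeries.coeff_one]
  split_ifs with h
  · simp [h, edgeDenom]
  · rfl

theorem coeff_add_single_expSMulEdgeSeries (c : ℚ) (a b : ℕ) (lam : ℕ →₀ ℕ) :
    MvPowerSeries.coeff (lam + Finsupp.single (a + 2) 1)
        (coeff (a + b + 1) (expSMulEdgeSeries c)) * ((lam (a + 2) + 1) * (a + 1).factorial) =
      c * MvPowerSeries.coeff lam (coeff b (expSMulEdgeSeries c)) := by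
  simp only [coeff_expSMulEdgeSeries, isHypertreeType_add_single]
  split_ifs
  · have hden : (edgeDenom lam : ℚ) ≠ 0 := mod_cast edgeDenom_ne_zero lam
    rw [edgeDenom_add_single, map_add, Finsupp.degree_single, pow_succ,
      Nat.add_sub_assoc one_le_two]
    push_cast
    field_simp
  · rw [zero_mul, mul_zero]

theorem coeff_X_mul_expSMulEdgeSeries (c : ℚ) (a b : ℕ) (lam : ℕ →₀ ℕ) :
    c * ((a.factorial : ℚ)⁻¹ * MvPowerSeries.coeff lam
        (MvPowerSeries.X (a + 2) * coeff b (expSMulEdgeSeries c))) =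
      MvPowerSeries.coeff lam (coeff (a + b + 1) (expSMulEdgeSeries c)) *
        (lam (a + 2) * (a + 1) : ℕ) := by
  rw [MvPowerSeries.X_def]
  by_cases hl : lam (a + 2) = 0
  · rw [MvPowerSeries.coeff_monomial_mul, if_neg (by rw [Finsupp.single_le_iff]; omega)]
    simp [hl]
  · obtain ⟨mu, rfl⟩ : ∃ mu, lam = Finsupp.single (a + 2) 1 + mu :=
      exists_add_of_le (Finsupp.single_le_iff.2 (Nat.one_le_iff_ne_zero.2 hl))
    rw [MvPowerSeries.coeff_add_monomial_mul, one_mul, mul_left_comm,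
      ← coeff_add_single_expSMulEdgeSeries c a b mu, add_comm mu, Finsupp.add_apply,
      Finsupp.single_eq_same, Nat.factorial_succ]
    push_cast
    field_simp
    ring

theorem derivative_edgeSeries :
    derivative EdgeRing edgeSeries = mk fun a =>
      ((a.factorial : ℚ)⁻¹) • (MvPowerSeries.X (a + 2) : EdgeRing) := by
  ext1 a
  rw [coeff_derivative, edgeSeries, coeff_mk, coeff_mk, if_neg a.succ_ne_zero, mul_comm,
    ← Nat.cast_add_one, ← nsmul_eq_mul, ← Nat.cast_smul_eq_nsmul ℚ, smul_smul,
    Nat.factorial_succ]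
  congr 1
  push_cast
  field_simp

theorem derivative_expSMulEdgeSeries (c : ℚ) :
    derivative EdgeRing (expSMulEdgeSeries c) =
      (c • derivative EdgeRing edgeSeries) * expSMulEdgeSeries c := by
  ext N lam
  have summand {p : ℕ × ℕ} (hp : p ∈ Finset.HasAntidiagonal.antidiagonal N) :
      MvPowerSeries.coeff lam (coeff p.1 (c • derivative EdgeRing edgeSeries) *
        coeff p.2 (expSMulEdgeSeries c)) =
      MvPowerSeries.coeff lam (coeff (N + 1) (expSMulEdgeSeries c)) *
        (lam (p.1 + 2) * (p.1 + 1) : ℕ) := by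
    rw [← Finset.HasAntidiagonal.mem_antidiagonal.1 hp, ← coeff_X_mul_expSMulEdgeSeries,
      derivative_edgeSeries, map_rat_smul]
    simp
  rw [coeff_derivative, ← Nat.cast_add_one, mul_comm, ← nsmul_eq_mul, map_nsmul, nsmul_eq_mul,
    coeff_mul, map_sum, Finset.sum_congr rfl fun p hp => summand hp, ← Finset.mul_sum,
    ← Nat.cast_sum, Finset.Nat.sum_antidiagonal_eq_sum_range_succ_mk, mul_comm]
  by_cases hc : IsHypertreeType lam (N + 1)
  · rw [hc.sum_range]
  · rw [coeff_expSMulEdgeSeries, if_neg hc, zero_mul, zero_mul]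

theorem hasSubst_edgeSeries : HasSubst edgeSeries :=
  .of_constantCoeff_zero' (by simp [edgeSeries])

theorem constantCoeff_exp_subst_edgeSeries :
    constantCoeff ((exp EdgeRing).subst edgeSeries : PowerSeries EdgeRing) = 1 := by
  rw [← coeff_zero_eq_constantCoeff_apply, coeff_subst' hasSubst_edgeSeries,
    finsum_eq_single _ 0]
  · simp
  · intro d hd
    simp [edgeSeries, hd]

theorem exp_subst_edgeSeries_pow (n : ℕ) :
    ((exp EdgeRing).subst edgeSeries : PowerSeries EdgeRing) ^ n = expSMulEdgeSeries n := by
  refine eq_of_derivative_eq_mul (c := (n : ℚ) • derivative EdgeRing edgeSeries) ?_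
    (derivative_expSMulEdgeSeries n) ?_
  · rw [Nat.cast_smul_eq_nsmul, derivative_pow, derivative_subst hasSubst_edgeSeries,
      derivative_exp]
    cases n with
    | zero => simp
    | succ n =>
      rw [nsmul_eq_mul, Nat.add_sub_cancel]
      ring
  · rw [map_pow, constantCoeff_exp_subst_edgeSeries, one_pow, constantCoeff_expSMulEdgeSeries]

end EdgeSeries

/-- A rooted hyperforest on the vertices `V` with edges `E`: each edge consists of a parent and a
set of children, no vertex is a child in two edges, and passing from parents to children is
well-founded. The components are rooted at the vertices that are not children. -/
@[ext]
structure RootedHyperforest (V E : Type*) where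
  children : E → Finset V
  parent : E → V
  pairwise_disjoint : Pairwise (Function.onFun Disjoint children)
  wellFounded : WellFounded fun u v => ∃ e, u = parent e ∧ v ∈ children e

namespace RootedHyperforest

variable {V E D : Type*} (F : RootedHyperforest V E)

theorem eq_of_mem {v : V} {e f : E} (he : v ∈ F.children e) (hf : v ∈ F.children f) : e = f :=
  by_contra fun hne => Finset.disjoint_left.1 (F.pairwise_disjoint hne) he hf

theorem parent_notMem (e : E) : F.parent e ∉ F.children e := fun h =>
  F.wellFounded.irrefl.irrefl _ ⟨e, rfl, h⟩

/-- A vertex is a root if it is not a child. -/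
def IsRoot (v : V) : Prop := ∀ e, v ∉ F.children e

theorem not_isRoot_iff {v : V} : ¬ F.IsRoot v ↔ ∃ e, v ∈ F.children e := by
  simp [IsRoot]

theorem induction_from_root {P : V → Prop} (isRoot : ∀ v, F.IsRoot v → P v)
    (child : ∀ e, P (F.parent e) → ∀ v ∈ F.children e, P v) (v : V) : P v := by
  induction v using F.wellFounded.induction with
  | _ v ih =>
    by_cases hv : F.IsRoot v
    · exact isRoot v hv
    · obtain ⟨e, he⟩ := F.not_isRoot_iff.1 hv
      exact child e (ih _ ⟨e, rfl, he⟩) v he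

open Classical in
/-- The root of the component of a vertex. -/
noncomputable def root : V → V :=
  F.wellFounded.fix fun v ih =>
    if h : ∃ e, v ∈ F.children e then ih (F.parent h.choose) ⟨_, rfl, h.choose_spec⟩ else v

theorem root_of_isRoot {v : V} (hv : F.IsRoot v) : F.root v = v := by
  rw [root, WellFounded.fix_eq, dif_neg (not_exists.2 hv)]

theorem root_of_mem {v : V} {e : E} (hv : v ∈ F.children e) : F.root v = F.root (F.parent e) := by
  have h : ∃ e, v ∈ F.children e := ⟨e, hv⟩
  rw [root, WellFounded.fix_eq, dif_pos h]
  exact congrArg (fun e => F.root (F.parent e)) (F.eq_of_mem h.choose_spec hv)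

theorem isRoot_root : ∀ v, F.IsRoot (F.root v) :=
  F.induction_from_root (fun v hv => by rwa [F.root_of_isRoot hv])
    fun e he v hv => by rwa [F.root_of_mem hv]

theorem reflTransGen_root : ∀ v,
    Relation.ReflTransGen (fun u v => ∃ e, u = F.parent e ∧ v ∈ F.children e) (F.root v) v :=
  F.induction_from_root (fun v hv => by rw [F.root_of_isRoot hv])
    fun e he v hv => by
      rw [F.root_of_mem hv]
      exact he.tail ⟨e, rfl, hv⟩

/-- The forest formed by some of the edges of a forest. -/
def comap (f : D ↪ E) : RootedHyperforest V D where
  children d := F.children (f d)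
  parent d := F.parent (f d)
  pairwise_disjoint := F.pairwise_disjoint.comp_of_injective f.injective
  wellFounded := Subrelation.wf (fun ⟨d, h⟩ => ⟨f d, h⟩) F.wellFounded

/-- The forest obtained by attaching some components below a vertex `p` of another component. -/
def addEdge (p : V) (b : Finset V) (hb : ∀ v ∈ b, F.IsRoot v) (hp : F.root p ∉ b) :
    RootedHyperforest V (Option E) where
  children e := e.elim b F.children
  parent e := e.elim p F.parent
  pairwise_disjoint := by
    rintro (_ | e) (_ | f) hne
    · exact absurd rfl hne
    · exact Finset.disjoint_left.2 fun v hv => hb v hv f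
    · exact Finset.disjoint_right.2 fun v hv => hb v hv e
    · exact F.pairwise_disjoint fun h => hne (congrArg some h)
  wellFounded := by
    -- Old descendants of `b` come after all other vertices; otherwise the old order is kept.
    refine Subrelation.wf ?_ (InvImage.wf (fun v => (F.root v ∈ b, v))
      (WellFounded.prod_lex wellFounded_lt F.wellFounded))
    rintro u v ⟨_ | e, rfl, hv⟩
    · have hroot : F.root v ∈ b := by rwa [F.root_of_isRoot (hb v hv)]
      exact Prod.Lex.left _ _ (lt_of_le_not_ge (fun h => absurd h hp) fun h => hp (h hroot))
    · refine Prod.lex_def.2 (Or.inr ⟨?_, e, rfl, hv⟩)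
      simp only [F.root_of_mem (e := e) hv, Option.elim_some]

theorem root_comap_parent_none_notMem (F : RootedHyperforest V (Option E)) :
    (F.comap .some).root (F.parent none) ∉ F.children none := fun h => by
  have descends : Relation.ReflTransGen (fun u v => ∃ e, u = F.parent e ∧ v ∈ F.children e)
      ((F.comap .some).root (F.parent none)) (F.parent none) :=
    Relation.ReflTransGen.mono (fun _ _ ⟨e, he⟩ => ⟨some e, he⟩) _ _
      ((F.comap .some).reflTransGen_root _)
  exact F.wellFounded.transGen.irrefl.irrefl _ (.head' ⟨none, rfl, h⟩ descends)

theorem isRoot_comap_some (F : RootedHyperforest V (Option E)) {v : V} (hv : v ∈ F.children none) :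
    (F.comap .some).IsRoot v := fun _ hv' =>
  Option.some_ne_none _ (F.eq_of_mem hv' hv)

open Classical in
/-- The set of roots of a forest. -/
noncomputable def roots [Fintype V] : Finset V := {v | F.IsRoot v}

theorem mem_roots [Fintype V] {v : V} : v ∈ F.roots ↔ F.IsRoot v := by
  simp [roots]

theorem card_roots [Fintype V] [Fintype E] :
    F.roots.card = Fintype.card V - ∑ e, (F.children e).card := by
  classical
  have roots_eq : F.roots = (Finset.univ.biUnion F.children)ᶜ := by
    ext v
    simp [mem_roots, IsRoot]
  rw [roots_eq, Finset.card_compl,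
    Finset.card_biUnion fun e _ f _ hne => F.pairwise_disjoint hne]

end RootedHyperforest

/-- The rooted hyperforests in which an edge `e` has `s e` children. -/
abbrev SizedForest (V : Type*) {E : Type*} (s : E → ℕ) : Type _ :=
  {F : RootedHyperforest V E // ∀ e, (F.children e).card = s e}

namespace SizedForest

variable {V D E : Type*}

instance [Finite V] [Finite E] (s : E → ℕ) : Finite (SizedForest V s) :=
  Finite.of_injective (fun F : SizedForest V s => (F.1.children, F.1.parent)) fun _ _ h =>
    Subtype.ext (RootedHyperforest.ext (congrArg Prod.fst h) (congrArg Prod.snd h))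

theorem card_roots [Fintype V] [Fintype E] {s : E → ℕ} (F : SizedForest V s) :
    F.1.roots.card = Fintype.card V - ∑ e, s e := by
  rw [F.1.card_roots, Finset.sum_congr rfl fun e _ => F.2 e]

/-- Forests with relabeled edges. -/
def congrEdges (f : D ≃ E) (s : E → ℕ) : SizedForest V s ≃ SizedForest V fun d => s (f d) where
  toFun F := ⟨F.1.comap f.toEmbedding, fun d => F.2 (f d)⟩
  invFun F := ⟨F.1.comap f.symm.toEmbedding, fun e =>
    (F.2 (f.symm e)).trans (congrArg s (f.apply_symm_apply e))⟩
  left_inv F := by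
    ext <;> simp [RootedHyperforest.comap]
  right_inv F := by
    ext <;> simp [RootedHyperforest.comap]

/-- A forest with one more edge is given by the parent in the new edge, which is arbitrary, and the
children, which are roots of other components. -/
noncomputable def optionEquiv [Fintype V] [DecidableEq V] (s : Option E → ℕ) :
    SizedForest V s ≃ Σ F : SizedForest V fun e => s (some e), Σ p : V,
      {b : Finset V // b ∈ (F.1.roots.erase (F.1.root p)).powersetCard (s none)} where
  toFun F := ⟨⟨F.1.comap .some, fun e => F.2 (some e)⟩, F.1.parent none, F.1.children none,
    Finset.mem_powersetCard.2 ⟨fun v hv => Finset.mem_erase.2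
      ⟨ne_of_mem_of_not_mem hv F.1.root_comap_parent_none_notMem,
        RootedHyperforest.mem_roots _ |>.2 (F.1.isRoot_comap_some hv)⟩, F.2 none⟩⟩
  invFun y :=
    have hb := Finset.mem_powersetCard.1 y.2.2.2
    ⟨y.1.1.addEdge y.2.1 y.2.2.1
      (fun _ hv => y.1.1.mem_roots.1 (Finset.mem_of_mem_erase (hb.1 hv)))
      (fun hv => Finset.notMem_erase _ _ (hb.1 hv)),
      fun e => e.rec hb.2 y.1.2⟩
  left_inv F := by
    apply Subtype.ext
    apply RootedHyperforest.ext <;> funext e <;> cases e <;> rfl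
  right_inv _ := rfl

theorem card_option [Fintype V] [Fintype E] (s : Option E → ℕ) :
    Nat.card (SizedForest V s) = Nat.card (SizedForest V fun e => s (some e)) *
      (Fintype.card V * (Fintype.card V - 1 - ∑ e, s (some e)).choose (s none)) := by
  classical
  have := Fintype.ofFinite (SizedForest V fun e => s (some e))
  have card_children (F : SizedForest V fun e => s (some e)) (p : V) : Nat.card {b : Finset V //
      b ∈ (F.1.roots.erase (F.1.root p)).powersetCard (s none)} =
      (Fintype.card V - 1 - ∑ e, s (some e)).choose (s none) := by
    rw [Nat.card_eq_fintype_card, Fintype.card_coe, Finset.card_powersetCard,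
      Finset.card_erase_of_mem (F.1.mem_roots.2 (F.1.isRoot_root p)), F.card_roots,
      Nat.sub_right_comm]
  simp only [Nat.card_congr (optionEquiv s), Nat.card_sigma, card_children, Finset.sum_const,
    Finset.card_univ, smul_eq_mul, Nat.card_eq_fintype_card (α := SizedForest V _)]

theorem card_mul_prod_factorial [Fintype V] [Fintype E] (s : E → ℕ) :
    Nat.card (SizedForest V s) * ∏ e, (s e).factorial =
      Fintype.card V ^ Fintype.card E * (Fintype.card V - 1).descFactorial (∑ e, s e) := by
  revert s
  refine Fintype.induction_empty_option (P := fun E _ => ∀ s : E → ℕ,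
    Nat.card (SizedForest V s) * ∏ e, (s e).factorial =
      Fintype.card V ^ Fintype.card E * (Fintype.card V - 1).descFactorial (∑ e, s e))
    ?_ ?_ ?_ E
  · intro D E _ f ih s
    let := Fintype.ofEquiv E f.symm
    rw [Nat.card_congr (congrEdges f s), ← Equiv.prod_comp f, ← Equiv.sum_comp f,
      ← Fintype.card_congr f]
    convert ih fun d => s (f d)
  · intro s
    have : Unique (SizedForest V s) :=
      { default := ⟨⟨PEmpty.elim, PEmpty.elim, fun e => e.elim,
          Subrelation.wf (fun ⟨e, _⟩ => e.elim) emptyWf.wf⟩, fun e => e.elim⟩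
        uniq := fun F => Subtype.ext (RootedHyperforest.ext (funext fun e => e.elim)
          (funext fun e => e.elim)) }
    simp
  · intro E _ ih s
    rw [card_option, Fintype.prod_option, Fintype.sum_option, Fintype.card_option,
      ← Nat.descFactorial_mul_descFactorial (Nat.le_add_left (∑ e, s (some e)) (s none)),
      Nat.add_sub_cancel, pow_succ, Nat.descFactorial_eq_factorial_mul_choose _ (s none)]
    linear_combination (Fintype.card V * (Fintype.card V - 1 - ∑ e, s (some e)).choose (s none) *
      (s none).factorial) * ih fun e => s (some e)

end SizedForest

namespace MultiHypergraph

variable {V E : Type*} {H : MultiHypergraph V E} {m : ℕ}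

theorem IsCycle.succ_mem_verts [NeZero m] {v : Fin (m + 1) → V} {e : Fin m → E}
    (h : H.IsCycle v e) (i : Fin m) : v (i + 1).castSucc ∈ H.verts (e i) := by
  obtain ⟨n, rfl⟩ := Nat.exists_eq_succ_of_ne_zero (NeZero.ne m)
  obtain ⟨hw, -, -, hclosed, -⟩ := h
  have hi := (hw i).2
  induction i using Fin.lastCases with
  | last => rwa [Fin.last_add_one, Fin.castSucc_zero, hclosed, ← Fin.succ_last]
  | cast i => rwa [Fin.coeSucc_eq_succ, ← Fin.succ_castSucc]

/-- The bipartite graph of incidences between vertices and edges. The cycles of a hypergraph are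
the cycles of this graph. -/
def incidenceGraph (H : MultiHypergraph V E) : SimpleGraph (V ⊕ E) where
  Adj
    | .inl v, .inr e => v ∈ H.verts e
    | .inr e, .inl v => v ∈ H.verts e
    | _, _ => False
  symm := ⟨by rintro (v | e) (w | f) h <;> exact h⟩
  loopless := ⟨by rintro (v | e) h <;> exact h⟩

theorem incidenceGraph_adj_inl_inr {v : V} {e : E} :
    H.incidenceGraph.Adj (.inl v) (.inr e) ↔ v ∈ H.verts e := Iff.rfl

theorem incidenceGraph_adj_inr_inl {v : V} {e : E} :
    H.incidenceGraph.Adj (.inr e) (.inl v) ↔ v ∈ H.verts e := Iff.rfl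

theorem exists_inr_of_adj_inl {v : V} {b : V ⊕ E} (h : H.incidenceGraph.Adj (.inl v) b) :
    ∃ e, b = .inr e ∧ v ∈ H.verts e := by
  rcases b with w | e
  · exact h.elim
  · exact ⟨e, rfl, h⟩

theorem exists_inl_of_adj_inr {e : E} {b : V ⊕ E} (h : H.incidenceGraph.Adj (.inr e) b) :
    ∃ v, b = .inl v ∧ v ∈ H.verts e := by
  rcases b with v | f
  · exact ⟨v, rfl, h⟩
  · exact h.elim

theorem reachable_of_mem_verts {u v : V} {e : E} (hu : u ∈ H.verts e) (hv : v ∈ H.verts e) :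
    H.incidenceGraph.Reachable (.inl u) (.inl v) :=
  (SimpleGraph.Adj.reachable (incidenceGraph_adj_inl_inr.2 hu)).trans
    (SimpleGraph.Adj.reachable (incidenceGraph_adj_inr_inl.2 hv))

theorem isLeft_getVert_iff_even {x : V} {b : V ⊕ E} (c : H.incidenceGraph.Walk (.inl x) b) {i : ℕ}
    (hi : i ≤ c.length) : (c.getVert i).isLeft ↔ Even i := by
  induction i with
  | zero => simp
  | succ i ih =>
    have hadj := c.adj_getVert_succ hi
    rw [Nat.even_add_one, ← ih (i.le_succ.trans hi)]
    rcases hc : c.getVert i with v | e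
    · rw [hc] at hadj
      obtain ⟨e, he, -⟩ := exists_inr_of_adj_inl hadj
      simp [he]
    · rw [hc] at hadj
      obtain ⟨v, hv, -⟩ := exists_inl_of_adj_inr hadj
      simp [hv]

theorem exists_isWalk_of_walk {x y : V} (c : H.incidenceGraph.Walk (.inl x) (.inl y)) :
    ∃ (m : ℕ) (v : Fin (m + 1) → V) (e : Fin m → E), H.IsWalk v e ∧ c.length = 2 * m ∧
      (∀ i : Fin (m + 1), c.getVert (2 * i) = .inl (v i)) ∧
      ∀ i : Fin m, c.getVert (2 * i + 1) = .inr (e i) := by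
  obtain ⟨m, hm⟩ := ((isLeft_getVert_iff_even c le_rfl).1 (by simp)).exists_two_nsmul
  rw [smul_eq_mul] at hm
  choose v hv using fun i : Fin (m + 1) => Sum.isLeft_iff.1 <|
    (isLeft_getVert_iff_even c (i := 2 * i) (by omega)).2 (even_two_mul _)
  choose e he using fun i : Fin m => Sum.isRight_iff.1 <| Sum.not_isLeft.1 <|
    (isLeft_getVert_iff_even c (i := 2 * i + 1) (by omega)).not.2 (by simp)
  refine ⟨m, v, e, fun i => ⟨?_, ?_⟩, hm, hv, he⟩
  · have hadj := c.adj_getVert_succ (i := 2 * i) (by omega)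
    rwa [he, ← Fin.val_castSucc i, hv] at hadj
  · have hadj := c.adj_getVert_succ (i := 2 * i + 1) (by omega)
    rwa [he, add_assoc, one_add_one_eq_two, ← mul_add_one, ← Fin.val_succ i, hv] at hadj

theorem isConnected_of_reachable
    (h : ∀ x y : V, H.incidenceGraph.Reachable (.inl x) (.inl y)) : H.IsConnected := by
  intro x y
  obtain ⟨c, hc⟩ := (h x y).exists_isPath
  obtain ⟨m, v, e, hw, hm, hv, he⟩ := exists_isWalk_of_walk c
  have inj {i j : ℕ} (hi : i ≤ c.length) (hj : j ≤ c.length)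
      (hij : c.getVert i = c.getVert j) : i = j := hc.getVert_injOn hi hj hij
  refine ⟨m, v, e, ⟨hw, fun i j hij => ?_, fun i j hij => ?_⟩, ?_, ?_⟩
  · have := inj (i := 2 * i) (j := 2 * j) (by omega) (by omega) (by rw [hv, hv, hij])
    omega
  · have := inj (i := 2 * i + 1) (j := 2 * j + 1) (by omega) (by omega) (by rw [he, he, hij])
    omega
  · exact Sum.inl_injective ((hv 0).symm.trans c.getVert_zero)
  · refine Sum.inl_injective ((hv (Fin.last m)).symm.trans ?_)
    rw [Fin.val_last, ← hm, c.getVert_length]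

theorem IsHypertree.not_isCycle_incidenceGraph (hH : H.IsHypertree) {x : V}
    (c : H.incidenceGraph.Walk (.inl x) (.inl x)) : ¬ c.IsCycle := by
  intro hc
  obtain ⟨m, v, e, hw, hm, hv, he⟩ := exists_isWalk_of_walk c
  have three_le := hc.three_le_length
  refine hH.2 m v e ⟨hw, by omega, fun i j hij => ?_, ?_, fun i j hij => ?_⟩
  · have := hc.getVert_injOn (x₁ := 2 * i + 1) (x₂ := 2 * j + 1)
      ⟨by omega, by omega⟩ ⟨by omega, by omega⟩ (by rw [he, he, hij])
    omega
  · refine Sum.inl_injective (β := E) ?_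
    rw [← hv, ← hv, Fin.val_last, ← hm, Fin.val_zero, mul_zero, c.getVert_zero, c.getVert_length]
  · have := hc.getVert_injOn' (x₁ := 2 * i) (x₂ := 2 * j)
      (show 2 * (i : ℕ) ≤ c.length - 1 by omega) (show 2 * (j : ℕ) ≤ c.length - 1 by omega)
      ((hv i.castSucc).trans ((congrArg _ hij).trans (hv j.castSucc).symm))
    omega

theorem IsHypertree.incidenceGraph_isAcyclic (hH : H.IsHypertree) :
    H.incidenceGraph.IsAcyclic := by
  classical
  rintro (x | e) c hc
  · exact hH.not_isCycle_incidenceGraph c hc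
  · obtain ⟨x, hx, -⟩ := exists_inl_of_adj_inr (c.adj_snd hc.not_nil)
    have hmem : Sum.inl x ∈ c.support := hx ▸ c.getVert_mem_support 1
    exact hH.not_isCycle_incidenceGraph (c.rotate _ hmem) (hc.rotate hmem)

theorem IsConnected.incidenceGraph_connected [Nonempty V] (hH : H.IsConnected) :
    H.incidenceGraph.Connected := by
  have reachable (x y : V) : H.incidenceGraph.Reachable (.inl x) (.inl y) := by
    obtain ⟨m, v, e, ⟨hw, -⟩, rfl, rfl⟩ := hH x y
    suffices ∀ i, H.incidenceGraph.Reachable (.inl (v 0)) (.inl (v i)) from this _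
    intro i
    induction i using Fin.induction with
    | zero => rfl
    | succ i ih => exact ih.trans (reachable_of_mem_verts (hw i).1 (hw i).2)
  obtain ⟨x⟩ := ‹Nonempty V›
  refine SimpleGraph.connected_iff_exists_forall_reachable _ |>.2 ⟨.inl x, ?_⟩
  rintro (y | e)
  · exact reachable x y
  · obtain ⟨y, hy⟩ := Finset.card_pos.1 (two_pos.trans_le (H.two_le_card e))
    exact (reachable x y).trans (SimpleGraph.Adj.reachable (incidenceGraph_adj_inl_inr.2 hy))

end MultiHypergraph

namespace RootedHyperforest

variable {V E : Type*} (F : RootedHyperforest V E)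

/-- The vertices of an edge: its parent and its children. -/
def edge (e : E) : Finset V := Finset.cons (F.parent e) (F.children e) (F.parent_notMem e)

theorem card_edge (e : E) : (F.edge e).card = (F.children e).card + 1 := Finset.card_cons _

theorem mem_edge {v : V} {e : E} : v ∈ F.edge e ↔ v = F.parent e ∨ v ∈ F.children e :=
  Finset.mem_cons

theorem mem_children_iff {v : V} {e : E} : v ∈ F.children e ↔ v ∈ F.edge e ∧ v ≠ F.parent e := by
  rw [mem_edge]
  refine ⟨fun hv => ⟨Or.inr hv, fun h => F.parent_notMem e (h ▸ hv)⟩, fun hv => ?_⟩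
  exact hv.1.resolve_left hv.2

/-- `F` arises from the hypergraph `H` by choosing `r` as the root: it has the edges of `H` and the
only root `r`. -/
structure IsRooting (H : MultiHypergraph V E) (r : V) : Prop where
  verts_eq : ∀ e, H.verts e = F.edge e
  isRoot_iff : ∀ v, F.IsRoot v ↔ v = r

variable {F} {F' : RootedHyperforest V E} {H : MultiHypergraph V E} {r : V}

theorem IsRooting.parent_mem (h : F.IsRooting H r) (e : E) : F.parent e ∈ H.verts e := by
  rw [h.verts_eq, mem_edge]
  exact Or.inl rfl

theorem IsRooting.mem_of_mem_children (h : F.IsRooting H r) {v : V} {e : E}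
    (hv : v ∈ F.children e) : v ∈ H.verts e := by
  rw [h.verts_eq, mem_edge]
  exact Or.inr hv

theorem IsRooting.isConnected (h : F.IsRooting H r) : H.IsConnected := by
  have reachable : ∀ v, H.incidenceGraph.Reachable (.inl r) (.inl v) :=
    F.induction_from_root (fun v hv => by rw [(h.isRoot_iff v).1 hv]) fun e he v hv =>
      he.trans (MultiHypergraph.reachable_of_mem_verts (h.parent_mem e)
        (h.mem_of_mem_children hv))
  exact MultiHypergraph.isConnected_of_reachable fun x y => (reachable x).symm.trans (reachable y)

/- A vertex of maximal depth on a cycle would be a child in both of the edges of the cycle that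
contain it. -/
theorem IsRooting.not_isCycle (h : F.IsRooting H r) {m : ℕ} (v : Fin (m + 1) → V)
    (e : Fin m → E) : ¬ H.IsCycle v e := by
  intro hc
  obtain ⟨n, rfl⟩ : ∃ n, m = n + 2 := Nat.exists_eq_add_of_le' hc.2.1
  have hsucc := hc.succ_mem_verts
  obtain ⟨hw, -, he, -, hv⟩ := hc
  obtain ⟨i, hi⟩ := Finite.exists_max fun i : Fin (n + 2) =>
    (F.wellFounded.apply (v i.castSucc)).rank
  have mem_children {j k : Fin (n + 2)} (hij : v i.castSucc ∈ H.verts (e j))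
      (hkj : v k.castSucc ∈ H.verts (e j)) (hne : k ≠ i) : v i.castSucc ∈ F.children (e j) := by
    rw [h.verts_eq, mem_edge] at hij hkj
    refine hij.resolve_left fun hparent => ?_
    have hk := hkj.resolve_left fun hk => hne (hv (hk.trans hparent.symm))
    exact (hi k).not_gt ((F.wellFounded.apply _).rank_lt_of_rel ⟨e j, hparent, hk⟩)
  have mem_next : v i.castSucc ∈ F.children (e i) :=
    mem_children (hw i).1 (hsucc i) (by simp)
  have mem_prev : v i.castSucc ∈ F.children (e (i - 1)) :=
    mem_children (by simpa using hsucc (i - 1)) (hw (i - 1)).1 (by simp)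
  exact absurd (he (F.eq_of_mem mem_prev mem_next)) (by simp)

theorem IsRooting.isHypertree (h : F.IsRooting H r) : H.IsHypertree :=
  ⟨h.isConnected, fun _ => h.not_isCycle⟩

theorem IsRooting.children_eq (h : F.IsRooting H r) (h' : F'.IsRooting H r) {e : E}
    (he : F'.parent e = F.parent e) : F'.children e = F.children e := by
  ext v
  rw [mem_children_iff, mem_children_iff, ← h.verts_eq, ← h'.verts_eq, he]

theorem IsRooting.unique (h : F.IsRooting H r) (h' : F'.IsRooting H r) : F = F' := by
  have eq_parent {e : E} (hnot : F.parent e ∉ F'.children e) : F'.parent e = F.parent e := by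
    have := h.parent_mem e
    rw [h'.verts_eq, mem_edge] at this
    exact (this.resolve_right hnot).symm
  have key : ∀ v e, F.parent e = v → F'.parent e = F.parent e := by
    refine F.induction_from_root (fun v hv e he => ?_) fun f ih v hv e he => ?_
    · exact eq_parent (he ▸ (h'.isRoot_iff v).2 ((h.isRoot_iff v).1 hv) e)
    · refine eq_parent fun hmem => F.parent_notMem e ?_
      rw [he] at hmem ⊢
      have hv' : v ∈ F'.children f := by rwa [h.children_eq h' (ih f rfl)]
      rwa [F'.eq_of_mem hmem hv']
  exact RootedHyperforest.ext (funext fun e => (h.children_eq h' (key _ e rfl)).symm)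
    (funext fun e => (key _ e rfl).symm)

end RootedHyperforest

namespace MultiHypergraph

variable {V E : Type*} {H : MultiHypergraph V E}

theorem existsUnique_mem_dist_lt_of_edge (hT : H.incidenceGraph.IsTree) (r : V) (e : E) :
    ∃! p, p ∈ H.verts e ∧
      H.incidenceGraph.dist (.inl r) (.inl p) < H.incidenceGraph.dist (.inl r) (.inr e) := by
  obtain ⟨b, ⟨hb, hd⟩, huniq⟩ :=
    existsUnique_adj_dist_lt hT (u := .inl r) (a := .inr e) Sum.inl_ne_inr
  obtain ⟨p, rfl, hp⟩ := exists_inl_of_adj_inr hb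
  exact ⟨p, ⟨hp, hd⟩, fun q hq => Sum.inl_injective (huniq _ hq)⟩

theorem existsUnique_mem_dist_lt_of_vertex (hT : H.incidenceGraph.IsTree) {r v : V} (hne : r ≠ v) :
    ∃! e, v ∈ H.verts e ∧
      H.incidenceGraph.dist (.inl r) (.inr e) < H.incidenceGraph.dist (.inl r) (.inl v) := by
  obtain ⟨b, ⟨hb, hd⟩, huniq⟩ := existsUnique_adj_dist_lt hT (Sum.inl_injective.ne hne)
  obtain ⟨e, rfl, he⟩ := exists_inr_of_adj_inl hb
  exact ⟨e, ⟨he, hd⟩, fun f hf => Sum.inr_injective (huniq _ hf)⟩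

theorem IsHypertree.exists_isRooting (hH : H.IsHypertree) (r : V) :
    ∃ F : RootedHyperforest V E, F.IsRooting H r := by
  have : Nonempty V := ⟨r⟩
  have hT : H.incidenceGraph.IsTree :=
    ⟨hH.1.incidenceGraph_connected, hH.incidenceGraph_isAcyclic⟩
  let d := H.incidenceGraph.dist (.inl r)
  choose p hp eq_parent using fun e => existsUnique_mem_dist_lt_of_edge hT r e
  have ne_root {e : E} {v : V} (hd : d (.inr e) < d (.inl v)) : r ≠ v := by
    rintro rfl
    simp [d] at hd
  refine ⟨⟨fun e => {v ∈ H.verts e | d (.inr e) < d (.inl v)}, p, fun e f hne => ?_,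
    Subrelation.wf ?_ (measure fun v => d (.inl v)).wf⟩, ⟨fun e => ?_, fun v => ⟨fun hv => ?_, ?_⟩⟩⟩
  · refine Finset.disjoint_left.2 fun v he hf => hne ?_
    rw [Finset.mem_filter] at he hf
    exact (existsUnique_mem_dist_lt_of_vertex hT (ne_root he.2)).unique he hf
  · rintro u v ⟨e, rfl, hv⟩
    exact (hp e).2.trans (Finset.mem_filter.1 hv).2
  · ext v
    rw [RootedHyperforest.mem_edge, Finset.mem_filter]
    refine ⟨fun hv => ?_, fun hv => hv.elim (fun h => h ▸ (hp e).1) And.left⟩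
    rcases (hT.dist_ne_of_adj (.inl r) (incidenceGraph_adj_inl_inr.2 hv)).lt_or_gt with hd | hd
    · exact Or.inl (eq_parent e v ⟨hv, hd⟩)
    · exact Or.inr ⟨hv, hd⟩
  · by_contra hne
    obtain ⟨e, he, -⟩ := existsUnique_mem_dist_lt_of_vertex hT (Ne.symm hne)
    exact hv e (Finset.mem_filter.2 he)
  · rintro rfl e hv
    exact ne_root (Finset.mem_filter.1 hv).2 rfl

end MultiHypergraph

/-- The forests with given numbers of children that have exactly one root. -/
abbrev SingleRootedForest (V : Type*) {E : Type*} (s : E → ℕ) : Type _ :=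
  {x : SizedForest V s × V // ∀ v, x.1.1.IsRoot v ↔ v = x.2}

theorem SingleRootedForest.roots_eq_singleton {V E : Type*} [Fintype V] {s : E → ℕ}
    (x : SingleRootedForest V s) : x.1.1.1.roots = {x.1.2} := by
  ext v
  rw [RootedHyperforest.mem_roots, Finset.mem_singleton, x.2]

theorem SingleRootedForest.card_mul_prod_factorial {V E : Type*} [Fintype V] [Fintype E]
    (s : E → ℕ) :
    Nat.card (SingleRootedForest V s) * ∏ e, (s e).factorial =
      if ∑ e, s e + 1 = Fintype.card V
      then Fintype.card V ^ Fintype.card E * (Fintype.card V - 1).factorial else 0 := by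
  split_ifs with h
  · have bijective : Function.Bijective fun x : SingleRootedForest V s => x.1.1 := by
      refine ⟨fun x y (hxy : x.1.1 = y.1.1) => Subtype.ext (Prod.ext hxy ?_), fun F => ?_⟩
      · rw [← y.2, ← hxy, x.2]
      · obtain ⟨r, hr⟩ := Finset.card_eq_one.1 (F.card_roots.trans (by omega))
        exact ⟨⟨(F, r), fun v => by rw [← F.1.mem_roots, hr, Finset.mem_singleton]⟩, rfl⟩
    rw [Nat.card_congr (Equiv.ofBijective _ bijective), SizedForest.card_mul_prod_factorial,
      ← Nat.descFactorial_self, ← h, Nat.add_sub_cancel]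
  · have : IsEmpty (SingleRootedForest V s) := by
      refine ⟨fun x => h ?_⟩
      have card_roots := x.1.1.card_roots
      rw [x.roots_eq_singleton, Finset.card_singleton] at card_roots
      omega
    rw [Nat.card_of_isEmpty, zero_mul]

section Counting

variable {n : ℕ} {lam : ℕ →₀ ℕ}

theorem two_le_of_edgeLabel (hlam : ∀ i < 2, lam i = 0) (x : Σ i : ℕ, Fin (lam i)) :
    2 ≤ x.1 := by
  by_contra! hx
  exact absurd x.2.pos (hlam _ hx).not_gt

/-- The labeled hypergraph formed by the edges of a forest. -/
def SizedForest.toLabeledHypergraph (hlam : ∀ i < 2, lam i = 0)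
    (F : SizedForest (Fin n) fun x : (Σ i : ℕ, Fin (lam i)) => x.1 - 1) :
    LabeledHypergraph n lam :=
  have card_edge (x : Σ i : ℕ, Fin (lam i)) : (F.1.edge x).card = x.1 := by
    rw [F.1.card_edge, F.2, Nat.sub_add_cancel (one_le_two.trans (two_le_of_edgeLabel hlam x))]
  { verts := F.1.edge
    two_le_card := fun x => (two_le_of_edgeLabel hlam x).trans_eq (card_edge x).symm
    card_verts := card_edge }

theorem SingleRootedForest.isRooting (hlam : ∀ i < 2, lam i = 0)
    (x : SingleRootedForest (Fin n) fun x : (Σ i : ℕ, Fin (lam i)) => x.1 - 1) :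
    x.1.1.1.IsRooting (x.1.1.toLabeledHypergraph hlam).toMultiHypergraph x.1.2 :=
  ⟨fun _ => rfl, x.2⟩

theorem rootedHypertreeCount_eq_card (hlam : ∀ i < 2, lam i = 0) :
    rootedHypertreeCount n lam =
      Nat.card (SingleRootedForest (Fin n) fun x : (Σ i : ℕ, Fin (lam i)) => x.1 - 1) := by
  let f : SingleRootedForest (Fin n) (fun x : (Σ i : ℕ, Fin (lam i)) => x.1 - 1) →
      {p : LabeledHypergraph n lam × Fin n // p.1.toMultiHypergraph.IsHypertree} :=
    fun x => ⟨(x.1.1.toLabeledHypergraph hlam, x.1.2), (x.isRooting hlam).isHypertree⟩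
  refine (Nat.card_congr (Equiv.ofBijective f ⟨fun x y hxy => ?_, ?_⟩)).symm
  · have hH : x.1.1.toLabeledHypergraph hlam = y.1.1.toLabeledHypergraph hlam :=
      congrArg (fun p => p.1.1) hxy
    have hr : x.1.2 = y.1.2 := congrArg (fun p => p.1.2) hxy
    have hy := y.isRooting hlam
    rw [← hH, ← hr] at hy
    exact Subtype.ext (Prod.ext (Subtype.ext ((x.isRooting hlam).unique hy)) hr)
  · rintro ⟨⟨H, r⟩, hH⟩
    obtain ⟨F, hF⟩ := hH.exists_isRooting r
    have card_children (x : Σ i : ℕ, Fin (lam i)) : (F.children x).card = x.1 - 1 := by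
      rw [← H.card_verts x, hF.verts_eq, F.card_edge, Nat.add_sub_cancel]
    exact ⟨⟨(⟨F, card_children⟩, r), hF.isRoot_iff⟩, Subtype.ext <| Prod.ext
      (LabeledHypergraph.ext (funext fun x => (hF.verts_eq x).symm)) rfl⟩

theorem univ_edgeLabels [Fintype (Σ i : ℕ, Fin (lam i))] :
    (Finset.univ : Finset (Σ i : ℕ, Fin (lam i))) =
      lam.support.sigma fun i => (Finset.univ : Finset (Fin (lam i))) := by
  ext x
  simpa using x.2.pos.ne'

theorem prod_edgeLabels [Fintype (Σ i : ℕ, Fin (lam i))] {M : Type*} [CommMonoid M] (g : ℕ → M) :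
    ∏ x : (Σ i : ℕ, Fin (lam i)), g x.1 = lam.prod fun i k => g i ^ k := by
  simp [univ_edgeLabels, Finset.prod_sigma, Finsupp.prod]

theorem sum_edgeLabels [Fintype (Σ i : ℕ, Fin (lam i))] {M : Type*} [AddCommMonoid M]
    (g : ℕ → M) : ∑ x : (Σ i : ℕ, Fin (lam i)), g x.1 = lam.sum fun i k => k • g i := by
  simp [univ_edgeLabels, Finset.sum_sigma, Finsupp.sum]

theorem card_edgeLabels [Fintype (Σ i : ℕ, Fin (lam i))] :
    Fintype.card (Σ i : ℕ, Fin (lam i)) = lam.degree := by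
  rw [Fintype.card_eq_sum_ones, sum_edgeLabels fun _ => 1]
  simp [Finsupp.degree_apply, Finsupp.sum]

theorem eq_zero_of_labeledHypergraph (H : LabeledHypergraph n lam) {i : ℕ} (hi : i < 2) :
    lam i = 0 := by
  by_contra hl
  have hcard := H.card_verts ⟨i, 0, Nat.pos_of_ne_zero hl⟩
  exact absurd (H.two_le_card _) (hcard.trans_lt hi).not_ge

theorem rootedHypertreeCount_mul_prod_factorial (n : ℕ) (lam : ℕ →₀ ℕ) :
    rootedHypertreeCount (n + 1) lam * lam.prod (fun i k => (i - 1).factorial ^ k) =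
      if IsHypertreeType lam n then (n + 1) ^ lam.degree * n.factorial else 0 := by
  by_cases hlam : ∀ i < 2, lam i = 0
  · have := Fintype.ofFinite (Σ i : ℕ, Fin (lam i))
    rw [rootedHypertreeCount_eq_card hlam, ← prod_edgeLabels fun i => (i - 1).factorial,
      SingleRootedForest.card_mul_prod_factorial, Fintype.card_fin, card_edgeLabels,
      sum_edgeLabels fun i => i - 1, Nat.add_sub_cancel]
    exact if_congr (add_left_inj 1 |>.trans (and_iff_right hlam).symm) rfl rfl
  · have : IsEmpty (LabeledHypergraph (n + 1) lam) :=
      ⟨fun H => hlam fun _ => eq_zero_of_labeledHypergraph H⟩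
    rw [if_neg fun h => hlam h.1, rootedHypertreeCount, Nat.card_of_isEmpty, zero_mul]

theorem rootedHypertreeCount_eq_mul_hypertreeCount (n : ℕ) (lam : ℕ →₀ ℕ) :
    rootedHypertreeCount n lam = n * hypertreeCount n lam := by
  rw [rootedHypertreeCount, Nat.card_congr (Equiv.prodSubtypeFstEquivSubtypeProd
    (p := fun H : LabeledHypergraph n lam => H.toMultiHypergraph.IsHypertree)), Nat.card_prod,
    Nat.card_fin, mul_comm, hypertreeCount]

end Counting

section GeneratingFunctions

open PowerSeries

theorem coeff_egf (c : ℕ → (ℕ →₀ ℕ) → ℕ) (n : ℕ) (lam : ℕ →₀ ℕ) :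
    MvPowerSeries.coeff lam (coeff n (egf c)) =
      (c n lam : ℚ) / ((n.factorial : ℚ) * lam.prod fun _ k => (k.factorial : ℚ)) := by
  rw [egf, coeff_mk, EdgeRing.coeff_ofCoeff]

theorem constantCoeff_rootedHypertreeEGF : constantCoeff rootedHypertreeEGF = 0 := by
  rw [← coeff_zero_eq_constantCoeff_apply]
  ext lam
  rw [rootedHypertreeEGF, coeff_egf, rootedHypertreeCount_eq_mul_hypertreeCount, zero_mul,
    Nat.cast_zero, zero_div, map_zero]

theorem rootedHypertreeEGF_eq_X_mul_derivative :
    rootedHypertreeEGF = X * derivative EdgeRing hypertreeEGF := by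
  ext n lam
  cases n with
  | zero => simp [constantCoeff_rootedHypertreeEGF]
  | succ n =>
    rw [coeff_succ_X_mul, coeff_derivative, mul_comm, ← Nat.cast_add_one, ← nsmul_eq_mul,
      map_nsmul, nsmul_eq_mul, rootedHypertreeEGF, hypertreeEGF, coeff_egf, coeff_egf,
      if_neg n.succ_ne_zero, rootedHypertreeCount_eq_mul_hypertreeCount, Nat.cast_mul,
      mul_div_assoc]

theorem edgeDenom_eq_mul (lam : ℕ →₀ ℕ) :
    (edgeDenom lam : ℚ) = (lam.prod fun _ k => (k.factorial : ℚ)) *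
      (lam.prod fun i k => (i - 1).factorial ^ k : ℕ) := by
  simp [edgeDenom, Finsupp.prod, Finset.prod_mul_distrib]

theorem nsmul_coeff_succ_rootedHypertreeEGF (n : ℕ) :
    (n + 1) • coeff (n + 1) rootedHypertreeEGF =
      coeff n (expSMulEdgeSeries (n + 1 : ℕ)) := by
  ext lam
  have count : (rootedHypertreeCount (n + 1) lam : ℚ) *
      (lam.prod fun i k => (i - 1).factorial ^ k : ℕ) =
      if IsHypertreeType lam n then ((n + 1 : ℕ) : ℚ) ^ lam.degree * n.factorial else 0 :=
    mod_cast rootedHypertreeCount_mul_prod_factorial n lam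
  have hden : (edgeDenom lam : ℚ) ≠ 0 := mod_cast edgeDenom_ne_zero lam
  have hn : ((n + 1).factorial : ℚ) ≠ 0 := mod_cast (n + 1).factorial_ne_zero
  rw [edgeDenom_eq_mul] at hden
  obtain ⟨hP, hQ⟩ := mul_ne_zero_iff.1 hden
  rw [map_nsmul, nsmul_eq_mul, rootedHypertreeEGF, coeff_egf, coeff_expSMulEdgeSeries,
    eq_div_of_mul_eq hQ count, edgeDenom_eq_mul]
  split_ifs
  · rw [Nat.factorial_succ]
    push_cast
    field_simp
  · simp

end GeneratingFunctions

/-- Let `T` and `R` be the exponential generating functions of labeled hypertrees and of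
vertex-rooted labeled hypertrees. Then `R = t * ∂T/∂t`, the substitutions below are legitimate, and
`R = t * exp (∑_{j ≥ 1} u (j + 1) * R ^ j / j!)`. -/
theorem mainTheorem3 :
    rootedHypertreeEGF = PowerSeries.X * PowerSeries.derivative EdgeRing hypertreeEGF ∧
    PowerSeries.HasSubst rootedHypertreeEGF ∧
    PowerSeries.HasSubst (PowerSeries.subst rootedHypertreeEGF edgeSeries : PowerSeries EdgeRing) ∧
    rootedHypertreeEGF =
      PowerSeries.X *
        (PowerSeries.subst
          (PowerSeries.subst rootedHypertreeEGF edgeSeries : PowerSeries EdgeRing)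
          (PowerSeries.exp EdgeRing) : PowerSeries EdgeRing) := by
  have hR : PowerSeries.HasSubst rootedHypertreeEGF :=
    PowerSeries.HasSubst.of_constantCoeff_zero' constantCoeff_rootedHypertreeEGF
  refine ⟨rootedHypertreeEGF_eq_X_mul_derivative, hR, ?_, ?_⟩
  · exact PowerSeries.HasSubst.of_constantCoeff_zero
      (PowerSeries.constantCoeff_subst_eq_zero constantCoeff_rootedHypertreeEGF _
        (by simp [edgeSeries]))
  · rw [← PowerSeries.subst_comp_subst_apply hasSubst_edgeSeries hR]
    refine lagrange_inversion (by simp [constantCoeff_exp_subst_edgeSeries])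
      constantCoeff_rootedHypertreeEGF fun n => ?_
    rw [exp_subst_edgeSeries_pow, nsmul_coeff_succ_rootedHypertreeEGF]
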